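/- Let $\mathcal H=\mathbb C^d$, $\mathcal K=\mathbb C^{d'}$, let $\Theta\subset\mathbb R$ be an interval (of any kind) with more than one point, and let $\{\Lambda_\theta\}_{\theta\in\Theta}$ be a family of completely positive trace preserving maps from the operators on $\mathcal H$ to the operators on $\mathcal K$ that is differentiable in $\theta\in\Theta$. Let $\mathcal R$ be a reference system with $\dim\mathcal R=\dim\mathcal H$. For $n$ applications of the channel, an estimator is a pair $(\rho_n,M^n)$ of a state $\rho_n$ on $(\mathcal H\otimes\mathcal R)^{\otimes n}$ and a POVM $M^n$ on $(\mathcal K\otimes\mathcal R)^{\otimes n}$ with values in $\Theta$. When the parameter is $\theta$, the estimate $\hat\theta$ has the distribution $\operatorname{Tr}\big[(\Lambda_\theta\otimes\mathrm{id}_{\mathcal R})^{\otimes n}(\rho_n)\,M^n(d\hat\theta)\big]$; let $\eta_n(\theta)$ be its expectation and $\mathrm{MSE}_\theta(\rho_n,M^n)\in[0,\infty]$ the expectation of $(\hat\theta-\theta)^2$. A sequence $\{(\rho_n,M^n)\}$ satisfies the asymptotic locally unbiased condition if, for every $\theta_0\in\Theta$, $\lim_{n\to\infty}\eta_n(\theta_0)=\theta_0$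 and $\lim_{n\to\infty}\frac{d\eta_n}{d\theta}(\theta_0)=1$ (for all large $n$, $\eta_n$ being defined near $\theta_0$ and differentiable at $\theta_0$). At an endpoint of $\Theta$ that belongs to $\Theta$, neighbourhoods and derivatives are understood within $\Theta$. Let $J^S[\Lambda_\theta^{\otimes n}]\in[0,\infty]$ be the supremum, over all states $\rho$ on $(\mathcal H\otimes\mathcal R)^{\otimes n}$, of the SLD Fisher information at $\theta$ of the state family $\sigma_\theta=(\Lambda_\theta\otimes\mathrm{id}_{\mathcal R})^{\otimes n}(\rho)$, that is, of $\operatorname{Tr}\sigma_\theta L^2$ where $L$ is Hermitian with $\frac{d\sigma_\theta}{d\theta}=\frac12(L\sigma_\theta+\sigma_\theta L)$ (the value is $\infty$ if there is no such $L$). For $\alpha>0$ let $$\tilde C_\alpha[\Lambda_\theta]:=\inf\Big\{\limsup_{n\to\infty}n^\alpha\,\mathrm{MSE}_\theta(\rho_n,M^n)\ :\ \{(\rho_n,M^n)\}\text{ satisfies the asymptotic locally unbiased condition}\Big\}$$ be the Cramér–Rao bound, and let $$C_\alpha[\Lambda_{\theta_0}]:=\inf_{\{(\rho_n,M^n)\}}\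 \lim_{\epsilon\to0}\ \limsup_{n\to\infty}\ \sup_{\theta\in\Theta,\ |\theta-\theta_0|<\epsilon}n^\alpha\,\mathrm{MSE}_\theta(\rho_n,M^n)$$ be the local asymptotic mini-max bound, the infimum being over all sequences of estimators. Both bounds take values in $[0,\infty]$. Assume that $\theta\mapsto\tilde C_\alpha[\Lambda_\theta]$ is continuous on $\Theta$ and that $n^\alpha/J^S[\Lambda_\theta^{\otimes n}]\to\tilde C_\alpha[\Lambda_\theta]$ as $n\to\infty$, uniformly on every compact subset of $\Theta$ (with $|\infty-\infty|=0$ where the value $\infty$ occurs). Then, for every $\theta_0\in\Theta$, $$C_\alpha[\Lambda_{\theta_0}]\ \ge\ \tilde C_\alpha[\Lambda_{\theta_0}].$$ -/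

import Mathlib

open Filter Topology MeasureTheory Matrix
open scoped ENNReal ComplexOrder

noncomputable section

namespace ChannelEstimation

/-! ### Channels, their extension by a reference system, and their tensor powers

The space `ℂ^a` has the index type `a`, the product `ℂ^a ⊗ ℂ^r` the index type `a × r`, and the
`n`-fold tensor power of `ℂ^a` the index type `Fin n → a`. -/

/-- The map `Φ ⊗ id_r` on operators on `ℂ^a ⊗ ℂ^r`. -/
def ampliation {a b : Type*} (r : Type*)
    (Φ : Matrix a a ℂ →ₗ[ℂ] Matrix b b ℂ) :
    Matrix (a × r) (a × r) ℂ →ₗ[ℂ] Matrix (b × r) (b × r) ℂ where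
  toFun X := Matrix.of fun u v => Φ (Matrix.of fun i j => X (i, u.2) (j, v.2)) u.1 v.1
  map_add' X Y := by
    ext u v
    have h : (Matrix.of fun i j => (X + Y) (i, u.2) (j, v.2)) =
        (Matrix.of fun i j => X (i, u.2) (j, v.2)) +
          (Matrix.of fun i j => Y (i, u.2) (j, v.2)) := rfl
    simp only [Matrix.of_apply, Matrix.add_apply] at h ⊢
    rw [h, map_add, Matrix.add_apply]
  map_smul' c X := by
    ext u v
    have h : (Matrix.of fun i j => (c • X) (i, u.2) (j, v.2)) =
        c • (Matrix.of fun i j => X (i, u.2) (j, v.2)) := rfl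
    simp only [Matrix.of_apply, Matrix.smul_apply, RingHom.id_apply] at h ⊢
    rw [h, map_smul, Matrix.smul_apply]

/-- A quantum channel from `ℂ^d` to `ℂ^d'`: a completely positive trace preserving linear map. -/
structure Channel (d d' : ℕ) where
  /-- The underlying linear map on operators. -/
  map : Matrix (Fin d) (Fin d) ℂ →ₗ[ℂ] Matrix (Fin d') (Fin d') ℂ
  trace_map : ∀ X, (map X).trace = X.trace
  completelyPositive : ∀ (k : ℕ) (X : Matrix (Fin d × Fin k) (Fin d × Fin k) ℂ),
    X.PosSemidef → (ampliation (Fin k) map X).PosSemidef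

/-- The `n`-fold tensor power `Φ^{⊗ n}` of a linear map on operators: it is linear and
sends `|i₁⟩⟨j₁| ⊗ ⋯ ⊗ |iₙ⟩⟨jₙ|` to `Φ(|i₁⟩⟨j₁|) ⊗ ⋯ ⊗ Φ(|iₙ⟩⟨jₙ|)`. -/
def tensorPower {a b : Type*} [Fintype a] [DecidableEq a] (n : ℕ)
    (Φ : Matrix a a ℂ →ₗ[ℂ] Matrix b b ℂ) (X : Matrix (Fin n → a) (Fin n → a) ℂ) :
    Matrix (Fin n → b) (Fin n → b) ℂ :=
  Matrix.of fun u v => ∑ i : Fin n → a, ∑ j : Fin n → a,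
    X i j * ∏ k, Φ (Matrix.single (i k) (j k) 1) (u k) (v k)

/-- A density operator on `ℂ^m`. -/
structure State (m : Type*) [Fintype m] where
  /-- The density matrix. -/
  mat : Matrix m m ℂ
  posSemidef : mat.PosSemidef
  trace_eq_one : mat.trace = 1

theorem ampliation_single {a b r : Type*} [DecidableEq a] [DecidableEq r]
    (Φ : Matrix a a ℂ →ₗ[ℂ] Matrix b b ℂ) (i j : a × r) (u v : b × r) :
    ampliation r Φ (Matrix.single i j 1) u v =
      if i.2 = u.2 ∧ j.2 = v.2 then Φ (Matrix.single i.1 j.1 1) u.1 v.1 else 0 := by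
  obtain ⟨i1, i2⟩ := i
  obtain ⟨j1, j2⟩ := j
  simp only [ampliation, LinearMap.coe_mk, AddHom.coe_mk, Matrix.of_apply]
  split_ifs with h
  · obtain ⟨h1, h2⟩ := h
    refine congrFun (congrFun (congrArg (fun A => Φ A) ?_) u.1) v.1
    ext x y
    simp [Matrix.single_apply, h1, h2]
  · have : (Matrix.of fun x y => (Matrix.single (i1, i2) (j1, j2) (1 : ℂ)) (x, u.2) (y, v.2)) =
        0 := by
      ext x y
      simp only [Matrix.of_apply, Matrix.single_apply, Prod.mk.injEq, Matrix.zero_apply]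
      rw [if_neg]
      tauto
    rw [this]
    simp

/-- A Kraus decomposition of `Λ ⊗ id`, on matrix units. -/
theorem Channel.exists_kraus {d d' : ℕ} (Λ : Channel d d') (r : Type*) [DecidableEq r] :
    ∃ (m : ℕ) (G : Fin m → Matrix (Fin d' × r) (Fin d × r) ℂ), ∀ i j u v,
      ampliation r Λ.map (Matrix.single i j 1) u v = ∑ k, G k u i * star (G k v j) := by
  let w : Fin d × Fin d → ℂ := fun p => if p.1 = p.2 then 1 else 0
  have hw : (Matrix.vecMulVec w (star w)).PosSemidef := Matrix.posSemidef_vecMulVec_self_star w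
  obtain ⟨m, x, hx⟩ := Matrix.posSemidef_iff_eq_sum_vecMulVec.1
    (Λ.completelyPositive d _ hw)
  have key : ∀ s t b b', Λ.map (Matrix.single s t 1) b b' =
      ∑ k, x k (b, s) * star (x k (b', t)) := by
    intro s t b b'
    have h := congrFun (congrFun hx (b, s)) (b', t)
    simp only [Matrix.sum_apply, Matrix.vecMulVec_apply, Pi.star_apply] at h
    rw [← h]
    simp only [ampliation, LinearMap.coe_mk, AddHom.coe_mk, Matrix.of_apply]
    refine congrFun (congrFun (congrArg (fun A => Λ.map A) ?_) b) b'
    ext p q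
    simp only [Matrix.single_apply, Matrix.of_apply, Matrix.vecMulVec_apply, Pi.star_apply, w]
    by_cases h1 : s = p <;> by_cases h2 : t = q <;> simp [h1, h2, eq_comm]
  refine ⟨m, fun k => Matrix.of fun u i => if i.2 = u.2 then x k (u.1, i.1) else 0, ?_⟩
  intro i j u v
  rw [ampliation_single, key]
  by_cases h1 : i.2 = u.2 <;> by_cases h2 : j.2 = v.2 <;> simp [h1, h2]

theorem trace_ampliation_single {d d' : ℕ} (Λ : Channel d d') (r : Type*) [Fintype r]
    [DecidableEq r] (i j : Fin d × r) :
    (ampliation r Λ.map (Matrix.single i j 1)).trace = if i = j then 1 else 0 := by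
  obtain ⟨i1, i2⟩ := i
  obtain ⟨j1, j2⟩ := j
  have h := Λ.trace_map (Matrix.single i1 j1 1)
  have h' : (Matrix.single i1 j1 (1 : ℂ)).trace = if i1 = j1 then 1 else 0 := by
    split_ifs with h0
    · subst h0; simp
    · exact Matrix.trace_single_eq_of_ne _ _ _ h0
  rw [h'] at h
  simp only [Matrix.trace, Matrix.diag_apply] at h ⊢
  simp only [ampliation_single, Fintype.sum_prod_type]
  rw [Finset.sum_comm]
  by_cases h2 : i2 = j2
  · subst h2
    simp [h]
  · have : ∀ x : r, ¬ (i2 = x ∧ j2 = x) := fun x hx => h2 (hx.1.trans hx.2.symm)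
    simp [this, h2]

theorem posSemidef_tensorPower {d d' : ℕ} (Λ : Channel d d') {r : Type*} [Fintype r]
    [DecidableEq r] (n : ℕ) {X : Matrix (Fin n → Fin d × r) (Fin n → Fin d × r) ℂ}
    (hX : X.PosSemidef) : (tensorPower n (ampliation r Λ.map) X).PosSemidef := by
  obtain ⟨m, G, hG⟩ := Λ.exists_kraus r
  let T : (Fin n → Fin m) → Matrix (Fin n → Fin d' × r) (Fin n → Fin d × r) ℂ :=
    fun κ => Matrix.of fun u i => ∏ k, G (κ k) (u k) (i k)
  have : tensorPower n (ampliation r Λ.map) X = ∑ κ, T κ * X * (T κ)ᴴ := by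
    ext u v
    simp only [tensorPower, Matrix.of_apply, Matrix.sum_apply, Matrix.mul_apply,
      Matrix.conjTranspose_apply, hG, Finset.prod_univ_sum, Fintype.piFinset_univ,
      Finset.prod_mul_distrib, Finset.mul_sum, Finset.sum_mul, T, star_prod]
    rw [Finset.sum_comm]
    refine (Finset.sum_congr rfl fun j _ => Finset.sum_comm).trans ?_
    rw [Finset.sum_comm]
    refine Finset.sum_congr rfl fun κ _ => Finset.sum_congr rfl fun j _ =>
      Finset.sum_congr rfl fun i _ => ?_
    ring
  rw [this]
  exact Matrix.posSemidef_sum _ fun κ _ => hX.mul_mul_conjTranspose_same _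

theorem trace_tensorPower {d d' : ℕ} (Λ : Channel d d') {r : Type*} [Fintype r]
    [DecidableEq r] (n : ℕ) (X : Matrix (Fin n → Fin d × r) (Fin n → Fin d × r) ℂ) :
    (tensorPower n (ampliation r Λ.map) X).trace = X.trace := by
  simp only [Matrix.trace, Matrix.diag_apply, tensorPower, Matrix.of_apply]
  rw [Finset.sum_comm]
  refine Finset.sum_congr rfl fun i _ => ?_
  rw [Finset.sum_comm]
  have : ∀ j : Fin n → Fin d × r, ∑ u : Fin n → Fin d' × r,
      X i j * ∏ k, ampliation r Λ.map (Matrix.single (i k) (j k) 1) (u k) (u k) =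
        if i = j then X i j else 0 := by
    intro j
    rw [← Finset.mul_sum, ← Fintype.piFinset_univ,
      ← Finset.prod_univ_sum (fun _ => Finset.univ)
        (fun k x => ampliation r Λ.map (Matrix.single (i k) (j k) 1) x x)]
    have h := fun k => trace_ampliation_single Λ r (i k) (j k)
    simp only [Matrix.trace, Matrix.diag_apply] at h
    simp only [h]
    split_ifs with hij
    · simp [hij]
    · obtain ⟨k, hk⟩ := Function.ne_iff.1 hij
      rw [Finset.prod_eq_zero (Finset.mem_univ k) (by simp [hk]), mul_zero]
  simp [this]

/-- States on `(ℋ ⊗ ℛ)^{⊗ n}`, where `ℋ = ℂ^d` and the reference system `ℛ` has the same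
dimension as `ℋ`. -/
abbrev InputState (d n : ℕ) := State (Fin n → Fin d × Fin d)

/-- The output state `(Λ ⊗ id_ℛ)^{⊗ n}(ρ)` on `(𝒦 ⊗ ℛ)^{⊗ n}`. -/
def Channel.output {d d' n : ℕ} (Λ : Channel d d') (ρ : InputState d n) :
    State (Fin n → Fin d' × Fin d) where
  mat := tensorPower n (ampliation (Fin d) Λ.map) ρ.mat
  posSemidef := posSemidef_tensorPower Λ n ρ.posSemidef
  trace_eq_one := (trace_tensorPower Λ n ρ.mat).trans ρ.trace_eq_one

/-! ### SLD Fisher information -/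

/-- The entrywise derivative at `θ` of a curve of matrices parametrized by `Θ`. -/
def matDeriv {m : Type*} (Θ : Set ℝ) (ρ : ℝ → Matrix m m ℂ) (θ : ℝ) : Matrix m m ℂ :=
  Matrix.of fun i j => derivWithin (fun t => ρ t i j) Θ θ

/-- `L` is a symmetric logarithmic derivative (SLD) at `θ` of the state family `ρ`. -/
def IsSLD {m : Type*} [Fintype m] (Θ : Set ℝ) (ρ : ℝ → State m) (θ : ℝ)
    (L : Matrix m m ℂ) : Prop :=
  L.IsHermitian ∧ matDeriv Θ (fun t => (ρ t).mat) θ =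
    (1 / 2 : ℂ) • (L * (ρ θ).mat + (ρ θ).mat * L)

/-- The SLD Fisher information `Tr ρ_θ L²`. The value is the same for all SLDs `L`; it is `∞` if
there is no SLD. -/
def sldInfo {m : Type*} [Fintype m] (Θ : Set ℝ) (ρ : ℝ → State m) (θ : ℝ) : ℝ≥0∞ :=
  ⨅ (L : Matrix m m ℂ) (_ : IsSLD Θ ρ θ L), ENNReal.ofReal ((ρ θ).mat * (L * L)).trace.re

/-- `J^S[Λ_θ^{⊗ n}]`: the supremum over all input states (with reference system) of the SLD Fisher
information of the family of output states. -/
def channelSldInfo {d d' : ℕ} (Θ : Set ℝ) (Λ : ℝ → Channel d d') (n : ℕ) (θ : ℝ) : ℝ≥0∞ :=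
  ⨆ ρ : InputState d n, sldInfo Θ (fun t => (Λ t).output ρ) θ

/-! ### Measurements and estimators -/

/-- A positive operator valued measure on `ℂ^m` with outcomes in `α`. -/
structure POVM (α : Type*) [MeasurableSpace α] (m : Type*) [DecidableEq m] where
  /-- The countably additive operator valued set function. -/
  toVectorMeasure : VectorMeasure α (Matrix m m ℂ)
  posSemidef : ∀ s, MeasurableSet s → (toVectorMeasure s).PosSemidef
  univ_eq_one : toVectorMeasure Set.univ = 1

theorem trace_mul_re_nonneg {m : Type*} [Fintype m] {A B : Matrix m m ℂ}
    (hA : A.PosSemidef) (hB : B.PosSemidef) : 0 ≤ (A * B).trace.re := by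
  obtain ⟨k, x, rfl⟩ := Matrix.posSemidef_iff_eq_sum_vecMulVec.1 hB
  rw [Finset.mul_sum, Matrix.trace_sum, Complex.re_sum]
  refine Finset.sum_nonneg fun i _ => ?_
  rw [Matrix.mul_vecMulVec, Matrix.trace_vecMulVec, dotProduct_comm]
  exact (Complex.le_def.1 (hA.dotProduct_mulVec_nonneg (x i))).1

/-- The distribution `s ↦ Tr ρ M(s)` of the outcome of the measurement `M` in the state `ρ`. -/
def outcomeMeasure {α m : Type*} [MeasurableSpace α] [Fintype m] [DecidableEq m]
    (ρ : State m) (M : POVM α m) : Measure α :=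
  Measure.ofMeasurable
    (fun s _ => ENNReal.ofReal (ρ.mat * M.toVectorMeasure s).trace.re)
    (by simp)
    (by
      intro f hf hd
      have h := M.toVectorMeasure.m_iUnion hf hd
      have hc : Continuous fun X : Matrix m m ℂ => (ρ.mat * X).trace.re := by fun_prop
      let g : Matrix m m ℂ →+ ℝ :=
        { toFun := fun X => (ρ.mat * X).trace.re
          map_zero' := by simp
          map_add' := fun X Y => by simp [mul_add] }
      have h2 : HasSum (fun i => (ρ.mat * M.toVectorMeasure (f i)).trace.re)
          (ρ.mat * M.toVectorMeasure (⋃ i, f i)).trace.re := h.map g hc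
      rw [← h2.tsum_eq]
      exact ENNReal.ofReal_tsum_of_nonneg
        (fun i => trace_mul_re_nonneg ρ.posSemidef (M.posSemidef _ (hf i))) h2.summable)

theorem outcomeMeasure_apply {α m : Type*} [MeasurableSpace α] [Fintype m] [DecidableEq m]
    (ρ : State m) (M : POVM α m) {s : Set α} (hs : MeasurableSet s) :
    outcomeMeasure ρ M s = ENNReal.ofReal (ρ.mat * M.toVectorMeasure s).trace.re :=
  Measure.ofMeasurable_apply s hs

/-- An estimator for `n` applications of the channel: an input state on `(ℋ ⊗ ℛ)^{⊗ n}` and a POVM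
on `(𝒦 ⊗ ℛ)^{⊗ n}` with values in the parameter space `Θ`. -/
structure Estimator (d d' : ℕ) (Θ : Set ℝ) (n : ℕ) where
  /-- The input state. -/
  state : InputState d n
  /-- The measurement. -/
  povm : POVM Θ (Fin n → Fin d' × Fin d)

/-- The distribution of the estimate when the channel is `Λ`. -/
def Estimator.law {d d' n : ℕ} {Θ : Set ℝ} (E : Estimator d d' Θ n) (Λ : Channel d d') :
    Measure Θ :=
  outcomeMeasure (Λ.output E.state) E.povm

/-- The expectation of the estimate when the channel is `Λ`. -/
def Estimator.mean {d d' n : ℕ} {Θ : Set ℝ} (E : Estimator d d' Θ n) (Λ : Channel d d') : ℝ :=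
  ∫ x, (x : ℝ) ∂(E.law Λ)

/-- The mean square error at the parameter `θ` when the channel is `Λ`. -/
def Estimator.mse {d d' n : ℕ} {Θ : Set ℝ} (E : Estimator d d' Θ n) (Λ : Channel d d')
    (θ : ℝ) : ℝ≥0∞ :=
  ∫⁻ x, ENNReal.ofReal (((x : ℝ) - θ) ^ 2) ∂(E.law Λ)

/-- The asymptotic locally unbiased condition: at every point `θ₀` of `Θ` the expectation of the
estimate converges to `θ₀` and its derivative converges to `1`. It is part of the condition that
for all large `n` the expectation exists near `θ₀` and is differentiable at `θ₀`. -/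
def IsAsympLocallyUnbiased {d d' : ℕ} {Θ : Set ℝ} (Λ : ℝ → Channel d d')
    (E : ∀ n, Estimator d d' Θ n) : Prop :=
  ∀ θ₀ ∈ Θ,
    (∀ᶠ n in atTop,
      (∀ᶠ θ in 𝓝[Θ] θ₀, Integrable (fun x : Θ => (x : ℝ)) ((E n).law (Λ θ))) ∧
        DifferentiableWithinAt ℝ (fun θ => (E n).mean (Λ θ)) Θ θ₀) ∧
    Tendsto (fun n => (E n).mean (Λ θ₀)) atTop (𝓝 θ₀) ∧
    Tendsto (fun n => derivWithin (fun θ => (E n).mean (Λ θ)) Θ θ₀) atTop (𝓝 1)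

/-! ### The two bounds -/

/-- The Cramér–Rao bound `C̃_α[Λ_θ]`: the infimum of `limsup n^α MSE_θ` over the asymptotically
locally unbiased sequences of estimators. -/
def cramerRaoBound {d d' : ℕ} (Θ : Set ℝ) (Λ : ℝ → Channel d d') (α : ℝ) (θ : ℝ) : ℝ≥0∞ :=
  ⨅ (E : ∀ n, Estimator d d' Θ n) (_ : IsAsympLocallyUnbiased Λ E),
    limsup (fun n : ℕ => (n : ℝ≥0∞) ^ α * (E n).mse (Λ θ) θ) atTop

/-- The quantity `limsup_n sup_{θ ∈ U_{θ₀,ε}} n^α MSE_θ`. -/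
def localRisk {d d' : ℕ} {Θ : Set ℝ} (Λ : ℝ → Channel d d') (α : ℝ)
    (E : ∀ n, Estimator d d' Θ n) (θ₀ ε : ℝ) : ℝ≥0∞ :=
  limsup (fun n : ℕ => ⨆ θ ∈ Metric.ball θ₀ ε ∩ Θ, (n : ℝ≥0∞) ^ α * (E n).mse (Λ θ) θ) atTop

/-- The local asymptotic mini-max risk of a sequence of estimators, the limit of `localRisk` as
`ε → 0`. As `localRisk` is monotone in `ε`, the limit is the infimum over `ε > 0`
(see `tendsto_localRisk`). -/
def localMinimaxRisk {d d' : ℕ} {Θ : Set ℝ} (Λ : ℝ → Channel d d') (α : ℝ)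
    (E : ∀ n, Estimator d d' Θ n) (θ₀ : ℝ) : ℝ≥0∞ :=
  ⨅ (ε : ℝ) (_ : 0 < ε), localRisk Λ α E θ₀ ε

theorem tendsto_localRisk {d d' : ℕ} {Θ : Set ℝ} (Λ : ℝ → Channel d d') (α : ℝ)
    (E : ∀ n, Estimator d d' Θ n) (θ₀ : ℝ) :
    Tendsto (fun ε => localRisk Λ α E θ₀ ε) (𝓝[>] 0) (𝓝 (localMinimaxRisk Λ α E θ₀)) := by
  have hm : Monotone (fun ε => localRisk Λ α E θ₀ ε) := by
    intro ε ε' h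
    refine limsup_le_limsup (Eventually.of_forall fun n => ?_)
    exact biSup_mono fun θ hθ => ⟨Metric.ball_subset_ball h hθ.1, hθ.2⟩
  have h := hm.tendsto_nhdsGT 0
  rw [sInf_image] at h
  exact h

/-- The local asymptotic mini-max bound `C_α[Λ_{θ₀}]`. -/
def localMinimaxBound {d d' : ℕ} (Θ : Set ℝ) (Λ : ℝ → Channel d d') (α : ℝ) (θ₀ : ℝ) : ℝ≥0∞ :=
  ⨅ E : ∀ n, Estimator d d' Θ n, localMinimaxRisk Λ α E θ₀

/-- Uniform convergence on the compact subsets of `Θ`, for functions with values in `[0, ∞]`: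
`|F n θ - f θ| ≤ ε`, where `|∞ - ∞|` counts as `0`. -/
def CompactlyUniform (Θ : Set ℝ) (F : ℕ → ℝ → ℝ≥0∞) (f : ℝ → ℝ≥0∞) : Prop :=
  ∀ K ⊆ Θ, IsCompact K → ∀ ε : ℝ≥0∞, 0 < ε → ∀ᶠ n in atTop, ∀ θ ∈ K,
    F n θ ≤ f θ + ε ∧ f θ ≤ F n θ + ε

end ChannelEstimation

end

/-!
The theorem is proved by contradiction. If the local minimax risk of some sequence of estimators
is below the Cramér–Rao bound at `θ₀`, then by continuity and compact uniform convergence there are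
constants `c < c₁ < c₂` and a nondegenerate interval `[a, b] ⊆ Θ` near `θ₀` on which, for all large
`n`, the mean square error is at most `c n⁻ᵅ` while the SLD information of every input state is
below `nᵅ / c₂`. The quantum Cramér–Rao inequality for biased estimates bounds the derivative of the
mean `η` by `√(c₁ / c₂) < 1` on `[a, b]`, so `η b - η a ≤ √(c₁ / c₂) (b - a)`. But the bias is
bounded by the root of the mean square error, which tends to `0`, so `η b - η a` tends to `b - a`.
Hence `b - a ≤ √(c₁ / c₂) (b - a)`,
a contradiction.

The estimates may be unbounded, and the mean need not be defined off `[a, b]`. Therefore the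
inequality is applied to an estimate clamped to `[a, b]` and rounded to finitely many values
(`exists_finite_rounding`), which increases the error by an arbitrarily small amount. Its mean is
`Tr σ_θ G` with `G = ∑ yᵢ Mᵢ`, and the Cramér–Rao inequality (`sq_deriv_mean_le`) follows from
Cauchy–Schwarz (`sq_re_trace_symm_mul_le`) and `G² ≤ ∑ yᵢ² Mᵢ` (`re_trace_sq_le`).
`length_le_of_mse_lt` integrates it over `[a, b]`.
-/

namespace ChannelEstimation

/-! ### Inequalities for traces against a state -/

/-- The Cauchy–Schwarz inequality for the symmetrized form `(L, X) ↦ Re Tr ½(Lσ + σL)X` on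
Hermitian matrices. -/
theorem sq_re_trace_symm_mul_le {m : Type*} [Fintype m] {σ L X : Matrix m m ℂ}
    (hσ : σ.PosSemidef) (hL : L.IsHermitian) (hX : X.IsHermitian) :
    (((1 / 2 : ℂ) • (L * σ + σ * L)) * X).trace.re ^ 2 ≤
      (σ * (L * L)).trace.re * (σ * (X * X)).trace.re := by
  have hD : (((1 / 2 : ℂ) • (L * σ + σ * L)) * X).trace.re =
      ((σ * (L * X)).trace.re + (σ * (X * L)).trace.re) / 2 := by
    have h1 : (L * σ * X).trace = (σ * (X * L)).trace := by
      rw [Matrix.mul_assoc, Matrix.trace_mul_comm, Matrix.mul_assoc]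
    have h2 : (1 / 2 : ℂ) = ((1 / 2 : ℝ) : ℂ) := by norm_num
    rw [Matrix.smul_mul, Matrix.trace_smul, smul_eq_mul, Matrix.add_mul, Matrix.trace_add, h1,
      Matrix.mul_assoc σ L X, h2, Complex.re_ofReal_mul, Complex.add_re]
    ring
  -- The quadratic polynomial `t ↦ Re Tr σ(L + tX)²` is nonnegative.
  have hq : ∀ t : ℝ, 0 ≤ (σ * (X * X)).trace.re * (t * t) +
      (2 * (((1 / 2 : ℂ) • (L * σ + σ * L)) * X).trace.re) * t + (σ * (L * L)).trace.re := by
    intro t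
    have hH : (L + (t : ℂ) • X)ᴴ = L + (t : ℂ) • X := by
      rw [Matrix.conjTranspose_add, Matrix.conjTranspose_smul, hL.eq, hX.eq]
      simp
    have hp := trace_mul_re_nonneg hσ (Matrix.posSemidef_conjTranspose_mul_self (L + (t : ℂ) • X))
    rw [hH] at hp
    simp only [Matrix.add_mul, Matrix.mul_add, Matrix.smul_mul, Matrix.mul_smul,
      Matrix.trace_add, Matrix.trace_smul, smul_eq_mul, Complex.add_re,
      Complex.re_ofReal_mul] at hp
    rw [hD]
    linarith
  have := discrim_le_zero hq
  rw [discrim] at this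
  nlinarith

/-- The operator Jensen inequality `(∑ yᵢ Mᵢ)² ≤ ∑ yᵢ² Mᵢ` for a finite POVM, tested against
a positive semidefinite matrix. -/
theorem re_trace_sq_le {m ι : Type*} [Fintype m] [DecidableEq m] [Fintype ι]
    {σ : Matrix m m ℂ} (hσ : σ.PosSemidef) {M : ι → Matrix m m ℂ} (hM : ∀ i, (M i).PosSemidef)
    (hM1 : ∑ i, M i = 1) (y : ι → ℝ) :
    (σ * ((∑ i, (y i : ℂ) • M i) * ∑ i, (y i : ℂ) • M i)).trace.re ≤
      ∑ i, y i ^ 2 * (σ * M i).trace.re := by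
  set G := ∑ i, (y i : ℂ) • M i with hG
  have hGH : Gᴴ = G := by
    simp [hG, Matrix.conjTranspose_sum, fun i => (hM i).isHermitian.eq]
  have hsum : ∑ i, ((y i : ℂ) • (1 : Matrix m m ℂ) - G) * M i * ((y i : ℂ) • 1 - G)ᴴ =
      ∑ i, ((y i : ℂ) ^ 2) • M i - G * G := by
    have h : ∀ i, ((y i : ℂ) • (1 : Matrix m m ℂ) - G) * M i * ((y i : ℂ) • 1 - G)ᴴ =
        ((y i : ℂ) ^ 2) • M i - ((y i : ℂ) • M i) * G - G * ((y i : ℂ) • M i) + G * M i * G := by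
      intro i
      have : ((y i : ℂ) • (1 : Matrix m m ℂ) - G)ᴴ = (y i : ℂ) • 1 - G := by
        rw [Matrix.conjTranspose_sub, hGH, Matrix.conjTranspose_smul]
        simp
      rw [this]
      simp only [Matrix.sub_mul, Matrix.mul_sub, Matrix.smul_mul, Matrix.mul_smul,
        Matrix.one_mul, Matrix.mul_one, smul_smul, smul_sub, pow_two]
      abel
    simp only [h, Finset.sum_add_distrib, Finset.sum_sub_distrib, ← Finset.sum_mul,
      ← Finset.mul_sum, hM1, ← hG, Matrix.mul_one]
    abel
  have hp := trace_mul_re_nonneg hσ (Matrix.posSemidef_sum Finset.univ fun i _ =>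
    (hM i).mul_mul_conjTranspose_same ((y i : ℂ) • (1 : Matrix m m ℂ) - G))
  rw [hsum, Matrix.mul_sub, Matrix.trace_sub, Complex.sub_re, sub_nonneg] at hp
  refine hp.trans_eq ?_
  rw [Finset.mul_sum, Matrix.trace_sum, Complex.re_sum]
  refine Finset.sum_congr rfl fun i _ => ?_
  rw [Matrix.mul_smul, Matrix.trace_smul, smul_eq_mul, ← Complex.ofReal_pow,
    Complex.re_ofReal_mul]

/-! ### Coarse-graining a measurement -/

/-- A real-valued estimate can be replaced by one with finitely many values, at the cost of an
arbitrarily small increase of the squared error, uniformly over the parameters in `[a, b]`. -/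
theorem exists_finite_rounding {a b δ : ℝ} (hab : a < b) (hδ : 0 < δ) :
    ∃ (N : ℕ) (y : Fin N → ℝ) (k : ℝ → Fin N), Measurable k ∧
      ∀ x, ∀ θ ∈ Set.Icc a b, (y (k x) - θ) ^ 2 ≤ (x - θ) ^ 2 + δ := by
  obtain ⟨N, hN⟩ := exists_nat_gt (2 * (b - a) ^ 2 / δ)
  have hba : 0 < b - a := sub_pos.2 hab
  have hN0 : (0 : ℝ) < N := lt_of_le_of_lt (by positivity) hN
  have hNδ : 2 * (b - a) ^ 2 < N * δ := (div_lt_iff₀ hδ).1 hN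
  -- Clamping to `[a, b]` brings the estimate closer to every `θ ∈ [a, b]`.
  let c : ℝ → ℝ := fun x => max a (min b x)
  have hca : ∀ x, a ≤ c x := fun x => le_max_left _ _
  have hcb : ∀ x, c x ≤ b := fun x => max_le hab.le (min_le_left _ _)
  let t : ℝ → ℝ := fun x => N * ((c x - a) / (b - a))
  have ht0 : ∀ x, 0 ≤ t x := fun x =>
    mul_nonneg hN0.le (div_nonneg (sub_nonneg.2 (hca x)) hba.le)
  have htN : ∀ x, t x ≤ N := fun x => by
    have : (c x - a) / (b - a) ≤ 1 := (div_le_one hba).2 (by linarith [hcb x])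
    nlinarith
  have hk : ∀ x, ⌊t x⌋₊ < N + 1 := fun x =>
    Nat.lt_succ_of_le (Nat.floor_le_of_le (htN x))
  have hmeas : Measurable fun x => ⌊t x⌋₊ := by
    refine Nat.measurable_floor.comp ?_
    fun_prop
  refine ⟨N + 1, fun i => a + (b - a) / N * i, fun x => ⟨⌊t x⌋₊, hk x⟩,
    measurable_to_countable' fun i => ?_, fun x θ hθ => ?_⟩
  · have : (fun x => (⟨⌊t x⌋₊, hk x⟩ : Fin (N + 1))) ⁻¹' {i} = (fun x => ⌊t x⌋₊) ⁻¹' {(i : ℕ)} := by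
      ext x
      simp [Fin.ext_iff]
    rw [this]
    exact hmeas (measurableSet_singleton _)
  have hc : c x = a + (b - a) / N * t x := by
    simp only [t]; field_simp; ring
  have hs : 0 < (b - a) / N := div_pos hba hN0
  have h1 : a + (b - a) / N * ⌊t x⌋₊ ≤ c x := by
    rw [hc]; gcongr; exact Nat.floor_le (ht0 x)
  have h2 : c x - (b - a) / N ≤ a + (b - a) / N * ⌊t x⌋₊ := by
    have := (Nat.lt_floor_add_one (t x)).le
    rw [hc]; nlinarith
  have h3 : a ≤ a + (b - a) / N * ⌊t x⌋₊ := by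
    have : 0 ≤ (b - a) / N * (⌊t x⌋₊ : ℝ) := by positivity
    linarith
  have h4 : (c x - θ) ^ 2 ≤ (x - θ) ^ 2 := by
    rcases le_total b x with hx | hx
    · have : c x = b := by simp only [c, min_eq_left hx, max_eq_right hab.le]
      rw [this]
      exact pow_le_pow_left₀ (sub_nonneg.2 hθ.2) (by linarith) 2
    · rcases le_total a x with hx' | hx'
      · have : c x = x := by simp only [c, min_eq_right hx, max_eq_right hx']
        rw [this]
      · have : c x = a := by simp only [c, min_eq_right hx, max_eq_left hx']
        rw [this, ← neg_sq (a - θ), ← neg_sq (x - θ)]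
        exact pow_le_pow_left₀ (by linarith [hθ.1]) (by linarith) 2
  have h5 : (b - a) / N * (2 * (b - a)) ≤ δ := by
    rw [div_mul_eq_mul_div, div_le_iff₀ hN0]; nlinarith
  simp only
  generalize a + (b - a) / N * (⌊t x⌋₊ : ℝ) = z at *
  have h6 : (z - θ) ^ 2 - (c x - θ) ^ 2 ≤ (b - a) / N * (2 * (b - a)) := by
    have h7 : (z - θ) ^ 2 - (c x - θ) ^ 2 = (c x - z) * (2 * θ - z - c x) := by ring
    rw [h7]
    refine (mul_le_mul_of_nonneg_left (?_ : _ ≤ 2 * (b - a)) (by linarith)).trans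
      (mul_le_mul_of_nonneg_right (by linarith) (by linarith))
    linarith [hθ.2, hca x]
  linarith

theorem POVM.sum_preimage_eq_one {α m ι : Type*} [MeasurableSpace α] [Fintype m] [DecidableEq m]
    [Fintype ι] [MeasurableSpace ι] [MeasurableSingletonClass ι] (M : POVM α m) {k : α → ι}
    (hk : Measurable k) : ∑ i, M.toVectorMeasure (k ⁻¹' {i}) = 1 := by
  have h := VectorMeasure.of_disjoint_iUnion (v := M.toVectorMeasure)
    (f := fun i => k ⁻¹' {i}) (fun i => hk (measurableSet_singleton i))
    (fun i j hij => Disjoint.preimage k (by simpa using hij))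
  rw [tsum_fintype] at h
  rw [← h, ← M.univ_eq_one]
  congr 1
  ext x
  simp

theorem outcomeMeasure_univ {α m : Type*} [MeasurableSpace α] [Fintype m] [DecidableEq m]
    (ρ : State m) (M : POVM α m) : outcomeMeasure ρ M Set.univ = 1 := by
  rw [outcomeMeasure_apply _ _ MeasurableSet.univ, M.univ_eq_one, Matrix.mul_one,
    ρ.trace_eq_one]
  simp

/-- The expectation of a function of a coarse-grained outcome. -/
theorem lintegral_outcomeMeasure_comp {α m ι : Type*} [MeasurableSpace α] [Fintype m]
    [DecidableEq m] [Fintype ι] [MeasurableSpace ι] [MeasurableSingletonClass ι] (ρ : State m)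
    (M : POVM α m) {k : α → ι} (hk : Measurable k) {f : ι → ℝ} (hf : ∀ i, 0 ≤ f i) :
    ∫⁻ x, ENNReal.ofReal (f (k x)) ∂(outcomeMeasure ρ M) =
      ENNReal.ofReal (∑ i, f i * (ρ.mat * M.toVectorMeasure (k ⁻¹' {i})).trace.re) := by
  have hms : ∀ i, MeasurableSet (k ⁻¹' {i}) := fun i => hk (measurableSet_singleton i)
  rw [← lintegral_map (f := fun i => ENNReal.ofReal (f i)) (measurable_of_finite _) hk,
    lintegral_fintype, ENNReal.ofReal_sum_of_nonneg fun i _ => mul_nonneg (hf i)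
      (trace_mul_re_nonneg ρ.posSemidef (M.posSemidef _ (hms i)))]
  refine Finset.sum_congr rfl fun i _ => ?_
  rw [Measure.map_apply hk (measurableSet_singleton i), outcomeMeasure_apply _ _ (hms i),
    ENNReal.ofReal_mul (hf i)]

/-! ### Differentiability of the output states -/

theorem differentiableOn_output {d d' n : ℕ} {Θ : Set ℝ} {Λ : ℝ → Channel d d'}
    (hΛ : ∀ X i j, DifferentiableOn ℝ (fun θ => (Λ θ).map X i j) Θ) (ρ : InputState d n)
    (u v : Fin n → Fin d' × Fin d) :
    DifferentiableOn ℝ (fun θ => ((Λ θ).output ρ).mat u v) Θ := by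
  simp only [Channel.output, tensorPower, ampliation, LinearMap.coe_mk, AddHom.coe_mk,
    Matrix.of_apply]
  refine DifferentiableOn.fun_sum fun i _ => DifferentiableOn.fun_sum fun j _ =>
    DifferentiableOn.const_mul (DifferentiableOn.fun_finsetProd fun k _ => hΛ _ _ _) _

theorem hasDerivWithinAt_re_trace_mul {m : Type*} [Fintype m] {Θ : Set ℝ}
    {σ : ℝ → Matrix m m ℂ} {θ : ℝ}
    (hσ : ∀ i j, DifferentiableWithinAt ℝ (fun t => σ t i j) Θ θ) (X : Matrix m m ℂ) :
    HasDerivWithinAt (fun t => (σ t * X).trace.re) (matDeriv Θ σ θ * X).trace.re Θ θ := by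
  have h : HasDerivWithinAt (fun t => (σ t * X).trace) (matDeriv Θ σ θ * X).trace Θ θ := by
    simp only [Matrix.trace, Matrix.diag_apply, Matrix.mul_apply, matDeriv, Matrix.of_apply]
    exact HasDerivWithinAt.fun_sum fun i _ => HasDerivWithinAt.fun_sum fun j _ =>
      (hσ i j).hasDerivWithinAt.mul_const _
  exact Complex.reCLM.hasFDerivAt.comp_hasDerivWithinAt θ h

/-! ### The integrated Cramér–Rao inequality -/

/-- Cramér–Rao for a finite-valued estimate: `(dη/dθ)² ≤ j w` if the SLD information is less than
`j` and the mean square error at most `w`. -/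
theorem sq_deriv_mean_le {m ι : Type*} [Fintype m] [DecidableEq m] [Fintype ι] {Θ : Set ℝ}
    {σ : ℝ → State m} {θ : ℝ} {M : ι → Matrix m m ℂ} (hM : ∀ i, (M i).PosSemidef)
    (hM1 : ∑ i, M i = 1) (y : ι → ℝ) {j w : ℝ}
    (hσ : ∀ u v, DifferentiableWithinAt ℝ (fun t => (σ t).mat u v) Θ θ)
    (hj : sldInfo Θ σ θ < ENNReal.ofReal j)
    (hw : ∑ i, (y i - θ) ^ 2 * ((σ θ).mat * M i).trace.re ≤ w) :
    ∃ η', HasDerivWithinAt (fun t => ((σ t).mat * ∑ i, (y i : ℂ) • M i).trace.re) η' Θ θ ∧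
      η' ^ 2 ≤ j * w := by
  -- Since `Tr σ_t = 1`, subtracting `θ` from the estimate changes the mean by a constant.
  set X := ∑ i, ((y i - θ : ℝ) : ℂ) • M i with hX
  have hXG : X = ∑ i, (y i : ℂ) • M i - (θ : ℂ) • 1 := by
    rw [hX, ← hM1, Finset.smul_sum, ← Finset.sum_sub_distrib]
    exact Finset.sum_congr rfl fun i _ => by rw [Complex.ofReal_sub, sub_smul]
  have hXH : X.IsHermitian := by
    simp only [Matrix.IsHermitian, hX, Matrix.conjTranspose_sum, Matrix.conjTranspose_smul,
      fun i => (hM i).isHermitian.eq, Complex.star_def, Complex.conj_ofReal]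
  simp only [sldInfo, iInf_lt_iff] at hj
  obtain ⟨L, hL, hLj⟩ := hj
  have hLj' := (ENNReal.ofReal_lt_ofReal_iff'.1 hLj).1
  have hder := hasDerivWithinAt_re_trace_mul hσ X
  have hcs := sq_re_trace_symm_mul_le (σ θ).posSemidef hL.1 hXH
  rw [← hL.2] at hcs
  have hmean : (fun t => ((σ t).mat * ∑ i, (y i : ℂ) • M i).trace.re) =
      fun t => ((σ t).mat * X).trace.re + θ := by
    ext t
    simp [hXG, Matrix.mul_sub, (σ t).trace_eq_one]
  refine ⟨_, hmean ▸ hder.add_const θ, hcs.trans ?_⟩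
  have h0 : 0 ≤ ((σ θ).mat * (X * X)).trace.re := by
    have := trace_mul_re_nonneg (σ θ).posSemidef (Matrix.posSemidef_conjTranspose_mul_self X)
    rwa [hXH.eq] at this
  have h1 : 0 ≤ ((σ θ).mat * (L * L)).trace.re := by
    have := trace_mul_re_nonneg (σ θ).posSemidef (Matrix.posSemidef_conjTranspose_mul_self L)
    rwa [hL.1.eq] at this
  exact mul_le_mul hLj'.le ((re_trace_sq_le (σ θ).posSemidef hM hM1 _).trans hw) h0
    (h1.trans hLj'.le)

/-- The squared bias of a finite-valued estimate is at most its mean square error. -/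
theorem sq_bias_le {m ι : Type*} [Fintype m] [DecidableEq m] [Fintype ι] (ρ : State m) (θ : ℝ)
    {M : ι → Matrix m m ℂ} (hM : ∀ i, (M i).PosSemidef) (hM1 : ∑ i, M i = 1) (y : ι → ℝ) :
    ((ρ.mat * ∑ i, (y i : ℂ) • M i).trace.re - θ) ^ 2 ≤
      ∑ i, (y i - θ) ^ 2 * (ρ.mat * M i).trace.re := by
  have hp : ∑ i, (ρ.mat * M i).trace.re = 1 := by
    rw [← Complex.re_sum, ← Matrix.trace_sum, ← Finset.mul_sum, hM1, Matrix.mul_one,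
      ρ.trace_eq_one, Complex.one_re]
  have hmean : (ρ.mat * ∑ i, (y i : ℂ) • M i).trace.re - θ =
      ∑ i, (ρ.mat * M i).trace.re • (y i - θ) := by
    simp only [smul_eq_mul, mul_sub, Finset.sum_sub_distrib, ← Finset.sum_mul, hp, one_mul]
    rw [Finset.mul_sum, Matrix.trace_sum, Complex.re_sum]
    congr 1
    refine Finset.sum_congr rfl fun i _ => ?_
    rw [Matrix.mul_smul, Matrix.trace_smul, smul_eq_mul, Complex.re_ofReal_mul, mul_comm]
  rw [hmean]
  have hconv : ConvexOn ℝ Set.univ fun x : ℝ => x ^ 2 := even_two.convexOn_pow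
  refine (hconv.map_sum_le
    (fun i _ => trace_mul_re_nonneg ρ.posSemidef (hM i)) hp fun i _ => Set.mem_univ _).trans_eq ?_
  exact Finset.sum_congr rfl fun i _ => by rw [smul_eq_mul, mul_comm]

/-- If on `[a, b] ⊆ Θ` the SLD information is less than `j` and the mean square error less than
`w`, then the mean of a finely rounded estimate has derivative at most `√(j w)` and bias at most
`√w`: from `a` to `b` it grows by at most `√(j w) (b - a)` and by at least `b - a - 2 √w`.
Rounding makes the mean a trace against a fixed matrix, so that it inherits the differentiability
of the states even if the original estimate is unbounded. -/
theorem length_le_of_mse_lt {m : Type*} [Fintype m] [DecidableEq m] {Θ : Set ℝ}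
    {σ : ℝ → State m} (M : POVM Θ m) {a b j w : ℝ} (hab : a < b) (hsub : Set.Icc a b ⊆ Θ)
    (hσ : ∀ u v, DifferentiableOn ℝ (fun t => (σ t).mat u v) Θ)
    (hj : ∀ θ ∈ Set.Icc a b, sldInfo Θ σ θ < ENNReal.ofReal j) {v : ℝ} (hv : 0 ≤ v) (hvw : v < w)
    (hmse : ∀ θ ∈ Set.Icc a b,
      ∫⁻ x, ENNReal.ofReal (((x : ℝ) - θ) ^ 2) ∂(outcomeMeasure (σ θ) M) ≤ ENNReal.ofReal v) :
    b - a ≤ √(j * w) * (b - a) + 2 * √w := by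
  obtain ⟨N, y, k, hk, hy⟩ := exists_finite_rounding hab (sub_pos.2 hvw)
  have hk' : Measurable fun x : Θ => k x := hk.comp measurable_subtype_coe
  set P : Fin N → Matrix m m ℂ := fun i => M.toVectorMeasure ((fun x : Θ => k x) ⁻¹' {i}) with hP
  have hPpos : ∀ i, (P i).PosSemidef := fun i =>
    M.posSemidef _ (hk' (measurableSet_singleton i))
  have hP1 : ∑ i, P i = 1 := M.sum_preimage_eq_one hk'
  have hw0 : 0 ≤ w := hv.trans hvw.le
  have hw : ∀ θ ∈ Set.Icc a b, ∑ i, (y i - θ) ^ 2 * ((σ θ).mat * P i).trace.re ≤ w := by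
    intro θ hθ
    rw [← ENNReal.ofReal_le_ofReal_iff hw0,
      ← lintegral_outcomeMeasure_comp (σ θ) M hk' (f := fun i => (y i - θ) ^ 2)
        fun i => sq_nonneg _]
    calc ∫⁻ x : Θ, ENNReal.ofReal ((y (k x) - θ) ^ 2) ∂(outcomeMeasure (σ θ) M)
        ≤ ∫⁻ x : Θ, (ENNReal.ofReal (((x : ℝ) - θ) ^ 2) + ENNReal.ofReal (w - v))
            ∂(outcomeMeasure (σ θ) M) := by
          refine lintegral_mono fun x => ?_
          rw [← ENNReal.ofReal_add (sq_nonneg _) (sub_pos.2 hvw).le]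
          exact ENNReal.ofReal_le_ofReal (hy x θ hθ)
      _ ≤ ENNReal.ofReal v + ENNReal.ofReal (w - v) := by
          rw [lintegral_add_right _ measurable_const, lintegral_const, outcomeMeasure_univ,
            mul_one]
          gcongr
          exact hmse θ hθ
      _ = ENNReal.ofReal w := by
          rw [← ENNReal.ofReal_add hv (sub_pos.2 hvw).le, add_sub_cancel]
  set η : ℝ → ℝ := fun t => ((σ t).mat * ∑ i, (y i : ℂ) • P i).trace.re with hη
  have hbias : ∀ θ ∈ Set.Icc a b, |η θ - θ| ≤ √w := fun θ hθ =>
    Real.abs_le_sqrt ((sq_bias_le (σ θ) θ hPpos hP1 y).trans (hw θ hθ))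
  have hder : ∀ θ ∈ Set.Icc a b, ∃ η', HasDerivWithinAt η η' Θ θ ∧ η' ^ 2 ≤ j * w :=
    fun θ hθ => sq_deriv_mean_le hPpos hP1 y (fun u v => hσ u v θ (hsub hθ)) (hj θ hθ) (hw θ hθ)
  choose! η' hη' hη'le using hder
  have hmvt := (convex_Icc a b).norm_image_sub_le_of_norm_hasDerivWithin_le
    (fun θ hθ => (hη' θ hθ).mono hsub)
    (fun θ hθ => (Real.abs_le_sqrt (hη'le θ hθ) : ‖η' θ‖ ≤ √(j * w)))
    (Set.left_mem_Icc.2 hab.le) (Set.right_mem_Icc.2 hab.le)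
  rw [Real.norm_eq_abs, Real.norm_of_nonneg (sub_nonneg.2 hab.le)] at hmvt
  have h1 := abs_le.1 (hbias a (Set.left_mem_Icc.2 hab.le))
  have h2 := abs_le.1 (hbias b (Set.right_mem_Icc.2 hab.le))
  linarith [(abs_le.1 hmvt).2, h1.2, h2.1]

/-! ### Nondegenerate intervals near a point of the parameter space -/

theorem exists_Icc_subset_inter {Θ U : Set ℝ} (hΘ : Θ.OrdConnected) (hΘ' : Θ.Nontrivial)
    {θ₀ : ℝ} (hθ₀ : θ₀ ∈ Θ) (hU : U ∈ 𝓝[Θ] θ₀) :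
    ∃ a b, a < b ∧ Set.Icc a b ⊆ Θ ∩ U := by
  obtain ⟨ε, hε, hεU⟩ := Metric.mem_nhdsWithin_iff.1 hU
  obtain ⟨θ₁, hθ₁, hne⟩ := hΘ'.exists_ne θ₀
  have key : ∀ x ∈ Θ, |x - θ₀| < ε → x ∈ Θ ∩ U := fun x hx h => ⟨hx, hεU ⟨h, hx⟩⟩
  rcases hne.lt_or_gt with h | h
  · refine ⟨max θ₁ (θ₀ - ε / 2), θ₀, max_lt h (by linarith), fun x hx => key x
      (hΘ.out hθ₁ hθ₀ ⟨(le_max_left _ _).trans hx.1, hx.2⟩) ?_⟩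
    rw [abs_lt]
    constructor <;> linarith [(le_max_right _ _).trans hx.1, hx.2]
  · refine ⟨θ₀, min θ₁ (θ₀ + ε / 2), lt_min h (by linarith), fun x hx => key x
      (hΘ.out hθ₀ hθ₁ ⟨hx.1, hx.2.trans (min_le_left _ _)⟩) ?_⟩
    rw [abs_lt]
    constructor <;> linarith [hx.2.trans (min_le_right _ _), hx.1]

end ChannelEstimation

/-! ### Comparison of the two bounds -/

theorem proposition1 {d d' : ℕ} (Θ : Set ℝ) (hΘ : Θ.OrdConnected) (hΘ' : Θ.Nontrivial)
    (Λ : ℝ → ChannelEstimation.Channel d d')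
    (hΛ : ∀ X i j, DifferentiableOn ℝ (fun θ => (Λ θ).map X i j) Θ)
    (α : ℝ) (hα : 0 < α)
    (hcont : ContinuousOn (ChannelEstimation.cramerRaoBound Θ Λ α) Θ)
    (hunif : ChannelEstimation.CompactlyUniform Θ
      (fun n θ => (n : ENNReal) ^ α / ChannelEstimation.channelSldInfo Θ Λ n θ)
      (ChannelEstimation.cramerRaoBound Θ Λ α))
    (θ₀ : ℝ) (hθ₀ : θ₀ ∈ Θ) :
    ChannelEstimation.cramerRaoBound Θ Λ α θ₀ ≤ ChannelEstimation.localMinimaxBound Θ Λ α θ₀ := by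
  refine le_iInf fun E => le_iInf₂ fun ε hε => ?_
  by_contra! hlt
  -- Separate the local risk from the Cramér–Rao bound by constants `c < c₁ < c₂ < c₃`.
  obtain ⟨c, hc, hlt⟩ := ENNReal.lt_iff_exists_nnreal_btwn.1 hlt
  obtain ⟨c₁, hc₁, hlt⟩ := ENNReal.lt_iff_exists_nnreal_btwn.1 hlt
  obtain ⟨c₂, hc₂, hlt⟩ := ENNReal.lt_iff_exists_nnreal_btwn.1 hlt
  obtain ⟨c₃, hc₃, hlt⟩ := ENNReal.lt_iff_exists_nnreal_btwn.1 hlt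
  norm_cast at hc₁ hc₂ hc₃
  have hc₂0 : (0 : ℝ) < c₂ := (NNReal.coe_nonneg c).trans_lt (by exact_mod_cast hc₁.trans hc₂)
  obtain ⟨a, b, hab, hsub⟩ := ChannelEstimation.exists_Icc_subset_inter hΘ hΘ' hθ₀
    (inter_mem ((hcont θ₀ hθ₀).eventually (lt_mem_nhds hlt))
      (mem_nhdsWithin_of_mem_nhds (Metric.ball_mem_nhds θ₀ hε)))
  have hsubΘ : Set.Icc a b ⊆ Θ := fun x hx => (hsub hx).1
  have hF := hunif (Set.Icc a b) hsubΘ isCompact_Icc ((c₃ - c₂ : NNReal) : ENNReal)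
    (by exact_mod_cast tsub_pos_of_lt hc₃)
  have hrisk := eventually_lt_of_limsup_lt hc
  -- On `[a, b]` the mean square error is at most `c n⁻ᵅ`, with room up to `c₁ n⁻ᵅ` for the
  -- rounding, and the information is less than `nᵅ / c₂`.
  have hev : ∀ᶠ n : ℕ in atTop,
      b - a ≤ √(c₁ / c₂) * (b - a) + 2 * √(c₁ * ((n : ℝ) ^ α)⁻¹) := by
    filter_upwards [hF, hrisk, eventually_gt_atTop 0] with n hFn hrn hn
    have hn0 : (0 : ℝ) < (n : ℝ) ^ α := Real.rpow_pos_of_pos (by exact_mod_cast hn) α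
    have hncast : (n : ENNReal) ^ α = ENNReal.ofReal ((n : ℝ) ^ α) := by
      rw [← ENNReal.ofReal_rpow_of_pos (by exact_mod_cast hn), ENNReal.ofReal_natCast]
    have hnE0 : (n : ENNReal) ^ α ≠ 0 := by rw [hncast]; simpa using hn0
    have hnEt : (n : ENNReal) ^ α ≠ ⊤ := by rw [hncast]; exact ENNReal.ofReal_ne_top
    have hcn : (c : ℝ) * ((n : ℝ) ^ α)⁻¹ < c₁ * ((n : ℝ) ^ α)⁻¹ :=
      mul_lt_mul_of_pos_right (by exact_mod_cast hc₁) (inv_pos.2 hn0)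
    have h := ChannelEstimation.length_le_of_mse_lt (E n).povm
      (σ := fun t => (Λ t).output (E n).state) (j := (n : ℝ) ^ α / c₂) hab hsubΘ
      (ChannelEstimation.differentiableOn_output hΛ (E n).state) ?_ (by positivity) hcn ?_
    · convert h using 4
      field_simp
    · intro θ hθ
      have hJ : ChannelEstimation.sldInfo Θ (fun t => (Λ t).output (E n).state) θ ≤
          ChannelEstimation.channelSldInfo Θ Λ n θ :=
        le_iSup (fun ρ => ChannelEstimation.sldInfo Θ (fun t => (Λ t).output ρ) θ) (E n).state
      refine hJ.trans_lt ?_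
      have h3 := (hsub hθ).2.1.trans_le (hFn θ hθ).2
      have h2 : (c₂ : ENNReal) <
          (n : ENNReal) ^ α / ChannelEstimation.channelSldInfo Θ Λ n θ := by
        have h4 : (c₃ : ENNReal) = c₂ + ((c₃ - c₂ : NNReal) : ENNReal) := by
          rw [← ENNReal.coe_add, add_tsub_cancel_of_le hc₃.le]
        rw [h4] at h3
        exact lt_of_add_lt_add_right h3
      have hc₂E : (c₂ : ENNReal) ≠ 0 := by
        rw [ENNReal.coe_ne_zero]; rintro rfl; simp at hc₂0
      rw [ENNReal.ofReal_div_of_pos hc₂0, ← hncast, ENNReal.ofReal_coe_nnreal,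
        ENNReal.lt_div_iff_mul_lt (Or.inl hc₂E) (Or.inl ENNReal.coe_ne_top), mul_comm]
      exact (ENNReal.lt_div_iff_mul_lt (Or.inr ENNReal.coe_ne_top) (Or.inr hc₂E)).1 h2
    · intro θ hθ
      have h1 : (n : ENNReal) ^ α * (E n).mse (Λ θ) θ ≤ c :=
        (le_iSup₂ (f := fun θ (_ : θ ∈ Metric.ball θ₀ ε ∩ Θ) =>
          (n : ENNReal) ^ α * (E n).mse (Λ θ) θ) θ ⟨(hsub hθ).2.2, (hsub hθ).1⟩).trans hrn.le
      rw [ENNReal.ofReal_mul (by positivity), ENNReal.ofReal_inv_of_pos hn0, ← hncast,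
        ENNReal.ofReal_coe_nnreal, ← div_eq_mul_inv,
        ENNReal.le_div_iff_mul_le (Or.inl hnE0) (Or.inl hnEt), mul_comm]
      exact h1
  have hlim : Tendsto (fun n : ℕ => √(c₁ / c₂) * (b - a) + 2 * √(c₁ * ((n : ℝ) ^ α)⁻¹)) atTop
      (𝓝 (√(c₁ / c₂) * (b - a) + 2 * √(c₁ * 0))) :=
    tendsto_const_nhds.add (((tendsto_inv_atTop_zero.comp ((tendsto_rpow_atTop hα).comp
      tendsto_natCast_atTop_atTop)).const_mul _).sqrt.const_mul _)
  have hle := ge_of_tendsto hlim hev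
  have hq : √((c₁ : ℝ) / c₂) < 1 := by
    rw [Real.sqrt_lt' one_pos, one_pow, div_lt_one hc₂0]
    exact_mod_cast hc₂
  simp only [mul_zero, Real.sqrt_zero, add_zero] at hle
  nlinarith
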